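/- For $0<q<1$ let $(a;q)_\infty=\prod_{k\ge 0}(1-aq^k)$ and let $\Gamma_q(x)=\frac{(q;q)_\infty}{(q^x;q)_\infty}(1-q)^{1-x}$ be Jackson's $q$-gamma function, with the convention $1/\Gamma_q(x)=0$ at its poles $x=0,-1,-2,\dots$. There is an absolute constant $C$ such that the following holds for all $q$ with $4\cdot 10^{-13}<q<1$; here $O(e^{\pi^2/\log q})$ denotes a quantity of absolute value at most $C\,e^{\pi^2/\log q}$ (so $C$ depends neither on $q$ nor on $x$), and all the infinite products displayed converge. (i) For all $x\in\mathbb R$, $$\sin(\pi x)=q^{\frac12(x-\frac12)^2}\frac{\Gamma_q(\frac12)^2}{\Gamma_q(x)\Gamma_q(1-x)}+O\big(e^{\pi^2/\log q}\big)=q^{\frac12(x-\frac12)^2}\prod_{k=0}^\infty\frac{(1-q^{k+x})(1-q^{k+1-x})}{(1-q^{k+1/2})^2}+O\big(e^{\pi^2/\log q}\big).$$ (ii) For all $x\in\mathbb R$, $$\sin(\pi x)=\frac{\pi\,q^{x(x-1)/2}(1-q)}{\log(q^{-1})\,\Gamma_q(x)\Gamma_q(1-x)}+O\big(e^{\pi^2/\log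 q}\big)=\frac{\pi\,q^{x(x-1)/2}}{\log(q^{-1})}\prod_{k=0}^\infty\frac{(1-q^{k+x})(1-q^{k+1-x})}{(1-q^{k+1})^2}+O\big(e^{\pi^2/\log q}\big).$$ (iii) For all $x\in\mathbb R\setminus\mathbb Z$, $$\pi=\sin(\pi x)\,q^{-x(x-1)/2}\,\frac{\log(q^{-1})\,\Gamma_q(x)\Gamma_q(1-x)}{1-q}+O\big(e^{\pi^2/\log q}\big)=\sin(\pi x)\,q^{-x(x-1)/2}\log(q^{-1})\prod_{k=0}^\infty\frac{(1-q^{k+1})^2}{(1-q^{k+x})(1-q^{k+1-x})}+O\big(e^{\pi^2/\log q}\big).$$ At an integer $x$ the two expressions in (iii) have removable singularities and are read as their limits, which exist and are equal to $\pi$. -/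

import Mathlib

open Filter Topology

noncomputable section

/-- The finite `q`-shifted factorial `(a;q)_n = ∏_{k<n} (1 - a q^k)`. -/
def qShifted (a q : ℝ) (n : ℕ) : ℝ :=
  ∏ k ∈ Finset.range n, (1 - a * q ^ k)

/-- The infinite `q`-shifted factorial `(a;q)_∞ = ∏_{k≥0} (1 - a q^k)`, for `|q| < 1`. -/
def qShiftedInf (a q : ℝ) : ℝ :=
  ∏' k : ℕ, (1 - a * q ^ k)

/-- For `|q| < 1` the infinite product converges, so that `∏'` is not a junk value. -/
theorem multipliable_qShifted (a : ℝ) {q : ℝ} (hq : |q| < 1) :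
    Multipliable fun k : ℕ => 1 - a * q ^ k := by
  have h : Summable fun k : ℕ => ‖-(a * q ^ k)‖ := by
    have h2 := (summable_geometric_of_abs_lt_one hq).mul_left a
    exact h2.neg.norm
  simpa [sub_eq_add_neg] using multipliable_one_add_of_summable h

/-- `(a;q)_∞` is the limit of `(a;q)_n`. -/
theorem tendsto_qShifted (a : ℝ) {q : ℝ} (hq : |q| < 1) :
    Tendsto (qShifted a q) atTop (𝓝 (qShiftedInf a q)) :=
  (multipliable_qShifted a hq).hasProd.tendsto_prod_nat

/-- Jackson's `q`-gamma function of a real variable, for `0 < q < 1`: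
`Γ_q(x) = (q;q)_∞ / (q^x;q)_∞ * (1-q)^(1-x)`.
At its poles `x = 0, -1, -2, …` we have `(q^x;q)_∞ = 0`, so the division returns `0`; hence
`1 / Γ_q(x) = 0` there, which is the true value of the entire function `1 / Γ_q`. -/
def qGamma (q x : ℝ) : ℝ :=
  qShiftedInf q q / qShiftedInf (q ^ x) q * (1 - q) ^ (1 - x)

/-- `q^((x-1/2)^2/2) Γ_q(1/2)^2 / (Γ_q(x) Γ_q(1-x))` -/
def sinApproxOne (q x : ℝ) : ℝ :=
  q ^ ((x - 1 / 2) ^ 2 / 2) * (qGamma q (1 / 2) ^ 2 / (qGamma q x * qGamma q (1 - x)))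

/-- The factors of `∏_{k≥0} (1-q^(k+x)) (1-q^(k+1-x)) / (1-q^(k+1/2))^2`. -/
def sinFactorOne (q x : ℝ) (k : ℕ) : ℝ :=
  (1 - q ^ ((k : ℝ) + x)) * (1 - q ^ ((k : ℝ) + 1 - x)) / (1 - q ^ ((k : ℝ) + 1 / 2)) ^ 2

/-- `π q^(x(x-1)/2) (1-q) / (log(1/q) Γ_q(x) Γ_q(1-x))` -/
def sinApproxTwo (q x : ℝ) : ℝ :=
  Real.pi * q ^ (x * (x - 1) / 2) *
    ((1 - q) / (Real.log q⁻¹ * qGamma q x * qGamma q (1 - x)))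

/-- The factors of `∏_{k≥0} (1-q^(k+x)) (1-q^(k+1-x)) / (1-q^(k+1))^2`. -/
def sinFactorTwo (q x : ℝ) (k : ℕ) : ℝ :=
  (1 - q ^ ((k : ℝ) + x)) * (1 - q ^ ((k : ℝ) + 1 - x)) / (1 - q ^ ((k : ℝ) + 1)) ^ 2

/-- `sin(πx) q^(-x(x-1)/2) log(1/q) Γ_q(x) Γ_q(1-x) / (1-q)`, for `x` not an integer. -/
def piApprox (q x : ℝ) : ℝ :=
  Real.sin (Real.pi * x) * q ^ (-(x * (x - 1)) / 2) *
    (Real.log q⁻¹ * qGamma q x * qGamma q (1 - x) / (1 - q))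

/-- The factors of `∏_{k≥0} (1-q^(k+1))^2 / ((1-q^(k+x)) (1-q^(k+1-x)))`. -/
def piFactor (q x : ℝ) (k : ℕ) : ℝ :=
  (1 - q ^ ((k : ℝ) + 1)) ^ 2 / ((1 - q ^ ((k : ℝ) + x)) * (1 - q ^ ((k : ℝ) + 1 - x)))

/-- `sin(πx) q^(-x(x-1)/2) log(1/q) ∏_{k≥0} (1-q^(k+1))^2 / ((1-q^(k+x)) (1-q^(k+1-x)))`,
for `x` not an integer. -/
def piApproxProd (q x : ℝ) : ℝ :=
  Real.sin (Real.pi * x) * q ^ (-(x * (x - 1)) / 2) * Real.log q⁻¹ * ∏' k : ℕ, piFactor q x k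

end

/-!
With `q = e^{-t}` and `c = 2π²/t`, so that `e^{π²/log q} = e^{-c/2}`, the function
`qTheta q x = q^((x-1/2)²/2) (q^x;q)_∞ (q^(1-x);q)_∞` is, up to a constant factor, the theta series
`∑_{n ∈ ℤ} (-1)^n q^((n+x-1/2)²/2)` by Jacobi's triple product identity (`tsum_eq_mul_qShiftedInf`).
Poisson summation (`hasSum_neg_one_pow_mul_exp_mul_sin`) turns this series into a multiple of
`∑_{n ≥ 0} (-1)^n e^{-c n(n+1)} sin ((2n+1)πx) = sin (πx) V(x)`, where `V = thetaSinQuot c` is the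
corresponding series of Dirichlet kernels. Hence `K * qTheta q x = sin (πx) V(x)` with `K > 0`
independent of `x` (`exists_pos_mul_qTheta_eq`).

The constant `K` is eliminated by evaluating this at `x = 1/2` or by comparing derivatives at
`x = 0` (`pi_mul_eq_of_mul_qTheta_eq`). This gives closed forms for the three approximations:
`sin (πx) V(x)/V(1/2)`, `sin (πx) V(x)/V(0)` and `π V(0)/V(x)`.

Finally `|V(x) - 1|` is at most a multiple of `e^{-2c}` uniformly in `x`, and the lower bound on `q`
keeps `V` away from `0`, so every quotient of two values of `V` is `1 + O(e^{-2c})`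
(`abs_one_sub_thetaSinQuot_div_le`), which is stronger than needed. The limits at integers hold
since `V` is continuous and takes the same value at all integers.
-/

/-! ### The triple product identity -/

theorem qShifted_succ (a q : ℝ) (n : ℕ) :
    qShifted a q (n + 1) = qShifted a q n * (1 - a * q ^ n) :=
  Finset.prod_range_succ _ _

theorem qShifted_self_pos {q : ℝ} (h0 : 0 < q) (h1 : q < 1) (n : ℕ) : 0 < qShifted q q n := by
  refine Finset.prod_pos fun k _ => ?_
  rw [← pow_succ', sub_pos]
  exact pow_lt_one₀ h0.le h1 k.succ_ne_zero

theorem antitone_qShifted_self {q : ℝ} (h0 : 0 < q) (h1 : q < 1) : Antitone (qShifted q q) := by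
  refine antitone_nat_of_succ_le fun n => ?_
  rw [qShifted_succ]
  refine mul_le_of_le_one_right (qShifted_self_pos h0 h1 n).le ?_
  have := mul_pos h0 (pow_pos h0 n)
  linarith

theorem qShiftedInf_self_pos {q : ℝ} (h0 : 0 < q) (h1 : q < 1) : 0 < qShiftedInf q q := by
  have hq : |q| < 1 := by rwa [abs_of_pos h0]
  refine lt_of_le_of_ne
    (ge_of_tendsto' (tendsto_qShifted q hq) fun n => (qShifted_self_pos h0 h1 n).le) (Ne.symm ?_)
  have h : ∏' k : ℕ, (1 + -(q * q ^ k)) ≠ 0 := by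
    refine tprod_one_add_ne_zero_of_summable (fun k => ?_) ?_
    · rw [← sub_eq_add_neg, ← pow_succ']
      exact (sub_pos.mpr (pow_lt_one₀ h0.le h1 k.succ_ne_zero)).ne'
    · exact ((summable_geometric_of_abs_lt_one hq).mul_left q).neg.norm
  simpa [qShiftedInf, sub_eq_add_neg] using h

/-- The reciprocal `1 / (q;q)_m` for an integer `m`, with the usual value `0` for `m < 0`. -/
noncomputable def qFactRecip (q : ℝ) (m : ℤ) : ℝ :=
  if m < 0 then 0 else (qShifted q q m.toNat)⁻¹

theorem qFactRecip_natCast (q : ℝ) (n : ℕ) : qFactRecip q n = (qShifted q q n)⁻¹ := by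
  simp [qFactRecip]

theorem qFactRecip_of_neg (q : ℝ) {m : ℤ} (hm : m < 0) : qFactRecip q m = 0 := if_pos hm

/-- The recurrence of `1 / (q;q)_m` holds at all integers, since `1 - q ^ 0 = 0`. -/
theorem qFactRecip_sub_one {q : ℝ} (h0 : 0 < q) (h1 : q < 1) (m : ℤ) :
    qFactRecip q (m - 1) = (1 - q ^ m) * qFactRecip q m := by
  rcases lt_trichotomy m 0 with hm | rfl | hm
  · rw [qFactRecip_of_neg q hm, qFactRecip_of_neg q (by omega), mul_zero]
  · rw [qFactRecip_of_neg q (by omega)]; simp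
  · obtain ⟨n, rfl⟩ : ∃ n : ℕ, m = ((n + 1 : ℕ) : ℤ) := ⟨(m - 1).toNat, by omega⟩
    have e : ((n + 1 : ℕ) : ℤ) - 1 = (n : ℕ) := by push_cast; ring
    rw [e, qFactRecip_natCast, qFactRecip_natCast, qShifted_succ, zpow_natCast, pow_succ']
    have h2 := (qShifted_self_pos h0 h1 n).ne'
    have h3 := (qShifted_self_pos h0 h1 (n + 1)).ne'
    rw [qShifted_succ] at h3
    have h4 := right_ne_zero_of_mul h3
    field_simp

theorem qFactRecip_nonneg {q : ℝ} (h0 : 0 < q) (h1 : q < 1) (m : ℤ) : 0 ≤ qFactRecip q m := by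
  unfold qFactRecip
  split_ifs
  · rfl
  · exact (inv_pos.mpr (qShifted_self_pos h0 h1 _)).le

theorem qFactRecip_le {q : ℝ} (h0 : 0 < q) (h1 : q < 1) (m : ℤ) :
    qFactRecip q m ≤ (qShiftedInf q q)⁻¹ := by
  have hpos := qShiftedInf_self_pos h0 h1
  unfold qFactRecip
  split_ifs
  · exact (inv_pos.mpr hpos).le
  · exact inv_anti₀ hpos ((antitone_qShifted_self h0 h1).le_of_tendsto
      (tendsto_qShifted q (by rwa [abs_of_pos h0])) _)

theorem tendsto_qFactRecip {q : ℝ} (h0 : 0 < q) (h1 : q < 1) :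
    Tendsto (qFactRecip q) atTop (𝓝 (qShiftedInf q q)⁻¹) := by
  have hnat : Tendsto Int.toNat atTop atTop := tendsto_atTop.mpr fun b => by
    filter_upwards [eventually_ge_atTop (b : ℤ)] with m hm
    omega
  have h := ((tendsto_qShifted q (by rwa [abs_of_pos h0])).inv₀
    (qShiftedInf_self_pos h0 h1).ne').comp hnat
  refine h.congr' ?_
  filter_upwards [eventually_ge_atTop 0] with m hm
  simp [qFactRecip, not_lt.mpr hm]

/-- The coefficients `(q;q)_{2n} / ((q;q)_{n-j} (q;q)_{n+j})` of the finite form of Jacobi's triple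
product: the `q`-binomial coefficients of `2n` over `n + j`. They vanish for `|j| > n`. -/
noncomputable def qCentralBinom (q : ℝ) (n : ℕ) (j : ℤ) : ℝ :=
  qShifted q q (2 * n) * (qFactRecip q (n - j) * qFactRecip q (n + j))

theorem qCentralBinom_zero (q : ℝ) (j : ℤ) : qCentralBinom q 0 j = if j = 0 then 1 else 0 := by
  unfold qCentralBinom
  rcases lt_trichotomy j 0 with hj | rfl | hj
  · rw [qFactRecip_of_neg q (m := ((0 : ℕ) : ℤ) + j) (by simpa using hj), if_neg hj.ne]; simp
  · simp [qFactRecip, qShifted]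
  · rw [qFactRecip_of_neg q (m := ((0 : ℕ) : ℤ) - j) (by simpa using hj), if_neg hj.ne']; simp

/-- The Pascal-type recurrence that corresponds to multiplying the finite triple product by its
next factor `(1 - z q^n) (1 - q^(n+1) / z)`. -/
theorem qCentralBinom_succ {q : ℝ} (h0 : 0 < q) (h1 : q < 1) (n : ℕ) (j : ℤ) :
    qCentralBinom q (n + 1) j = (1 + q ^ (2 * n + 1)) * qCentralBinom q n j +
      q ^ ((n : ℤ) + 1 - j) * qCentralBinom q n (j - 1) +
      q ^ ((n : ℤ) + 1 + j) * qCentralBinom q n (j + 1) := by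
  have hq := h0.ne'
  have a1 := qFactRecip_sub_one h0 h1 ((n : ℤ) + 1 - j)
  have a2 := qFactRecip_sub_one h0 h1 ((n : ℤ) - j)
  have b1 := qFactRecip_sub_one h0 h1 ((n : ℤ) + 1 + j)
  have b2 := qFactRecip_sub_one h0 h1 ((n : ℤ) + j)
  rw [show (n : ℤ) + 1 - j - 1 = n - j by ring] at a1
  rw [show (n : ℤ) + 1 + j - 1 = n + j by ring] at b1
  rw [a1, show (n : ℤ) - j - 1 = n - (j + 1) by ring] at a2
  rw [b1, show (n : ℤ) + j - 1 = n + (j - 1) by ring] at b2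
  unfold qCentralBinom
  rw [a1, b1, a2, b2, show (n : ℤ) - (j - 1) = n + 1 - j by ring,
    show (n : ℤ) + (j + 1) = n + 1 + j by ring,
    show 2 * (n + 1) = 2 * n + 1 + 1 by ring, qShifted_succ, qShifted_succ]
  push_cast
  set A := qFactRecip q ((n : ℤ) + 1 - j)
  set B := qFactRecip q ((n : ℤ) + 1 + j)
  have eu : q ^ ((n : ℤ) + 1 - j) = q * q ^ ((n : ℤ) - j) := by
    rw [show (n : ℤ) + 1 - j = 1 + (n - j) by ring, zpow_add₀ hq, zpow_one]
  have ev : q ^ ((n : ℤ) + 1 + j) = q * q ^ ((n : ℤ) + j) := by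
    rw [show (n : ℤ) + 1 + j = 1 + (n + j) by ring, zpow_add₀ hq, zpow_one]
  have euv : q ^ (2 * n) = q ^ ((n : ℤ) - j) * q ^ ((n : ℤ) + j) := by
    rw [← zpow_add₀ hq, ← zpow_natCast]; congr 1; push_cast; ring
  rw [eu, ev, pow_succ, euv]
  ring

theorem abs_qCentralBinom_le {q : ℝ} (h0 : 0 < q) (h1 : q < 1) (n : ℕ) (j : ℤ) :
    |qCentralBinom q n j| ≤ (qShiftedInf q q)⁻¹ * (qShiftedInf q q)⁻¹ := by
  have hp := (inv_pos.mpr (qShiftedInf_self_pos h0 h1)).le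
  have hle : qShifted q q (2 * n) ≤ 1 := by
    simpa [qShifted] using antitone_qShifted_self h0 h1 (Nat.zero_le (2 * n))
  have hw := mul_nonneg (qFactRecip_nonneg h0 h1 (n - j)) (qFactRecip_nonneg h0 h1 (n + j))
  unfold qCentralBinom
  rw [abs_of_nonneg (mul_nonneg (qShifted_self_pos h0 h1 _).le hw)]
  refine (mul_le_of_le_one_left hw hle).trans ?_
  exact mul_le_mul (qFactRecip_le h0 h1 _) (qFactRecip_le h0 h1 _) (qFactRecip_nonneg h0 h1 _) hp

theorem tendsto_qCentralBinom {q : ℝ} (h0 : 0 < q) (h1 : q < 1) (j : ℤ) :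
    Tendsto (fun n => qCentralBinom q n j) atTop (𝓝 (qShiftedInf q q)⁻¹) := by
  have hcast : Tendsto (fun n : ℕ => (n : ℤ)) atTop atTop := tendsto_natCast_atTop_atTop
  have hA := (tendsto_qFactRecip h0 h1).comp (tendsto_atTop_add_const_right _ (-j) hcast)
  have hB := (tendsto_qFactRecip h0 h1).comp (tendsto_atTop_add_const_right _ j hcast)
  have hP := (tendsto_qShifted q (by rwa [abs_of_pos h0])).comp
    (tendsto_id.const_mul_atTop' (show 0 < 2 by norm_num) : Tendsto (fun n : ℕ => 2 * n) _ _)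
  have h := hP.mul (hA.mul hB)
  rw [mul_inv_cancel_left₀ (qShiftedInf_self_pos h0 h1).ne'] at h
  exact h

/-- The finite form of Jacobi's triple product. The terms `T j`, determined up to a factor by their
recurrence, stand for `(-1)^j q^(j(j-1)/2) z^j`. -/
theorem hasSum_qCentralBinom_mul {q z : ℝ} (h0 : 0 < q) (h1 : q < 1) (hz : z ≠ 0) {T : ℤ → ℝ}
    (hT : ∀ j, T (j + 1) = -(q ^ j * z) * T j) (n : ℕ) :
    HasSum (fun j => qCentralBinom q n j * T j)
      (T 0 * (qShifted z q n * qShifted (q / z) q n)) := by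
  have hq := h0.ne'
  induction n with
  | zero =>
    convert hasSum_single (0 : ℤ) ?_ using 1
    · simp [qCentralBinom_zero, qShifted]
    · intro j hj; simp [qCentralBinom_zero, hj]
  | succ n ih =>
    have hr := (Equiv.subRight (1 : ℤ)).hasSum_iff.mpr (ih.mul_left (-(q ^ n * z)))
    have hl := (Equiv.addRight (1 : ℤ)).hasSum_iff.mpr (ih.mul_left (-(q ^ (n + 1) / z)))
    have hval : T 0 * (qShifted z q (n + 1) * qShifted (q / z) q (n + 1)) =
        (1 + q ^ (2 * n + 1)) * (T 0 * (qShifted z q n * qShifted (q / z) q n)) +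
          -(q ^ n * z) * (T 0 * (qShifted z q n * qShifted (q / z) q n)) +
          -(q ^ (n + 1) / z) * (T 0 * (qShifted z q n * qShifted (q / z) q n)) := by
      rw [qShifted_succ, qShifted_succ]
      field_simp
      ring
    rw [hval]
    refine (((ih.mul_left (1 + q ^ (2 * n + 1))).add hr).add hl).congr_fun fun j => ?_
    have e1 := hT (j - 1)
    have e2 := hT j
    rw [sub_add_cancel] at e1
    simp only [Function.comp_apply, Equiv.subRight_apply, Equiv.coe_addRight]
    rw [qCentralBinom_succ h0 h1, e2, e1, show (n : ℤ) + 1 - j = n - (j - 1) by ring,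
      zpow_sub₀ hq, show (n : ℤ) + 1 + j = (n + 1 : ℕ) + (1 + (j - 1)) by push_cast; ring,
      zpow_add₀ hq, show q ^ j = q ^ (1 + (j - 1)) by congr 1; ring, zpow_natCast, zpow_natCast]
    have := zpow_ne_zero (j - 1) hq
    field_simp
    ring

/-- Jacobi's triple product identity, obtained from its finite form by dominated convergence. -/
theorem tsum_eq_mul_qShiftedInf {q z : ℝ} (h0 : 0 < q) (h1 : q < 1) (hz : z ≠ 0) {T : ℤ → ℝ}
    (hT : ∀ j, T (j + 1) = -(q ^ j * z) * T j) (hs : Summable T) :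
    ∑' j, T j = qShiftedInf q q * (T 0 * (qShiftedInf z q * qShiftedInf (q / z) q)) := by
  have hq : |q| < 1 := by rwa [abs_of_pos h0]
  have hlim := tendsto_tsum_of_dominated_convergence
    (f := fun n j => qCentralBinom q n j * T j) (𝓕 := atTop)
    (hs.norm.mul_left ((qShiftedInf q q)⁻¹ * (qShiftedInf q q)⁻¹))
    (fun j => (tendsto_qCentralBinom h0 h1 j).mul_const (T j))
    (Eventually.of_forall fun n j => by
      rw [norm_mul, Real.norm_eq_abs]
      exact mul_le_mul_of_nonneg_right (abs_qCentralBinom_le h0 h1 n j) (norm_nonneg _))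
  simp_rw [(hasSum_qCentralBinom_mul h0 h1 hz hT _).tsum_eq, tsum_mul_left] at hlim
  have := tendsto_nhds_unique hlim
    (((tendsto_qShifted z hq).mul (tendsto_qShifted (q / z) hq)).const_mul (T 0))
  rw [← this, mul_inv_cancel_left₀ (qShiftedInf_self_pos h0 h1).ne']

/-! ### Poisson summation for the alternating Gaussian sum -/

theorem summable_exp_neg_mul_int_add_sq {c : ℝ} (hc : 0 < c) (y : ℝ) :
    Summable fun n : ℤ => Real.exp (-c * (n + y) ^ 2) := by
  have hpi := Real.pi_pos
  refine Summable.of_nonneg_of_le (fun n => (Real.exp_pos _).le) (fun n => ?_)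
    (summable_pow_mul_jacobiTheta₂_term_bound (c * |y| / Real.pi) (T := c / Real.pi)
      (by positivity) 0)
  rw [pow_zero, one_mul, Real.exp_le_exp]
  have e : -Real.pi * (c / Real.pi * (n : ℝ) ^ 2 - 2 * (c * |y| / Real.pi) * |(n : ℤ)|) =
      -c * n ^ 2 + c * (2 * (|y| * |(n : ℝ)|)) := by
    push_cast
    field_simp
    ring
  rw [e, ← abs_mul]
  have h1 := mul_le_mul_of_nonneg_left (neg_abs_le (y * n)) hc.le
  have h2 := mul_nonneg hc.le (sq_nonneg y)
  nlinarith

/-- Poisson summation for the alternating Gaussian sum: on the dual side the terms at `n` and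
`-(n + 1)` combine to a sine of odd frequency. -/
theorem hasSum_neg_one_pow_mul_exp_mul_sin {t : ℝ} (ht : 0 < t) (x : ℝ) :
    HasSum (fun n : ℕ => (-1) ^ n * Real.exp (-(2 * Real.pi ^ 2 / t) * (n * (n + 1))) *
        Real.sin ((2 * n + 1) * (Real.pi * x)))
      ((t / (2 * Real.pi)) ^ (1 / 2 : ℝ) * Real.exp (Real.pi ^ 2 / (2 * t)) / 2 *
        ∑' j : ℤ, (-1) ^ j * Real.exp (-(t / 2) * (j + (x - 1 / 2)) ^ 2)) := by
  have hpi := Real.pi_pos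
  have hpi' : (Real.pi : ℂ) ≠ 0 := by exact_mod_cast hpi.ne'
  have ht' : (t : ℂ) ≠ 0 := by exact_mod_cast ht.ne'
  set y := x - 1 / 2 with hy
  set a : ℝ := t / (2 * Real.pi) with ha
  have hapos : 0 < a := by positivity
  -- the dual side of Poisson summation, shifted by one so that `n` and `-(n + 1)` are conjugate
  set F : ℤ → ℂ := fun n => Real.exp (-(2 * Real.pi ^ 2 / t) * (n + 1 / 2) ^ 2) *
    Complex.exp (2 * Real.pi * (n + 1 / 2) * y * Complex.I) with hF
  have hFs : Summable F := by
    refine Summable.of_norm ((summable_exp_neg_mul_int_add_sq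
      (c := 2 * Real.pi ^ 2 / t) (by positivity) (1 / 2)).congr fun n => ?_)
    have : (2 * Real.pi * (n + 1 / 2) * y * Complex.I : ℂ) =
        ((2 * Real.pi * (n + 1 / 2) * y : ℝ) : ℂ) * Complex.I := by push_cast; ring
    rw [hF, norm_mul, this, Complex.norm_exp_ofReal_mul_I, mul_one, Complex.norm_real,
      Real.norm_of_nonneg (Real.exp_pos _).le]
  have hpois : ((∑' j : ℤ, (-1) ^ j * Real.exp (-(t / 2) * (j + y) ^ 2) : ℝ) : ℂ) =
      1 / (a : ℂ) ^ (1 / 2 : ℂ) * ∑' n, F n := by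
    have h := Complex.tsum_exp_neg_quadratic (a := (a : ℂ)) (by simpa using hapos)
      (-(t * y) / (2 * Real.pi) + Complex.I / 2)
    rw [← (Equiv.subRight (1 : ℤ)).tsum_eq F, Complex.ofReal_tsum]
    have hl : ∀ j : ℤ, (((-1) ^ j * Real.exp (-(t / 2) * (j + y) ^ 2) : ℝ) : ℂ) =
        Complex.exp (-(t * y ^ 2 / 2)) * Complex.exp (-Real.pi * a * j ^ 2 +
          2 * Real.pi * (-(t * y) / (2 * Real.pi) + Complex.I / 2) * j) := by
      intro j
      push_cast
      rw [← Complex.exp_pi_mul_I, ← Complex.exp_int_mul, ← Complex.exp_add, ← Complex.exp_add, ha]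
      congr 1
      push_cast
      field_simp
      ring
    have hr : ∀ j : ℤ, F (Equiv.subRight (1 : ℤ) j) =
        Complex.exp (-(t * y ^ 2 / 2)) * Complex.exp (-Real.pi / a *
          (j + Complex.I * (-(t * y) / (2 * Real.pi) + Complex.I / 2)) ^ 2) := by
      intro j
      rw [hF]
      simp only [Equiv.subRight_apply]
      push_cast
      rw [← Complex.exp_add, ← Complex.exp_add, ha]
      congr 1
      push_cast
      field_simp
      ring_nf
      simp only [Complex.I_sq, show Complex.I ^ 3 = -Complex.I from by
        rw [pow_succ, Complex.I_sq]; ring, Complex.I_pow_four]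
      ring
    simp_rw [hl, hr, tsum_mul_left, h]
    ring
  have hsum := hFs.hasSum.nat_add_neg_add_one
  have hroot : (a : ℂ) ^ (1 / 2 : ℂ) = ((a ^ (1 / 2 : ℝ) : ℝ) : ℂ) := by
    rw [Complex.ofReal_cpow hapos.le]; norm_num
  have hroot0 : ((a ^ (1 / 2 : ℝ) : ℝ) : ℂ) ≠ 0 := by
    exact_mod_cast (Real.rpow_pos_of_pos hapos _).ne'
  rw [← Complex.hasSum_ofReal]
  have hval : ((a ^ (1 / 2 : ℝ) * Real.exp (Real.pi ^ 2 / (2 * t)) / 2 *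
      ∑' j : ℤ, (-1) ^ j * Real.exp (-(t / 2) * (j + y) ^ 2) : ℝ) : ℂ) =
      (Real.exp (Real.pi ^ 2 / (2 * t)) / 2 : ℝ) * ∑' n, F n := by
    rw [Complex.ofReal_mul, hpois, hroot]
    push_cast
    field_simp
  rw [hval]
  refine (hsum.mul_left _).congr_fun fun n => ?_
  have hexp : Real.exp (-(2 * Real.pi ^ 2 / t) * (n * (n + 1))) =
      Real.exp (Real.pi ^ 2 / (2 * t)) *
        Real.exp (-(2 * Real.pi ^ 2 / t) * ((n : ℝ) + 1 / 2) ^ 2) := by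
    rw [← Real.exp_add]
    congr 1
    field_simp
    ring
  have hsin : (-1) ^ n * Real.sin ((2 * n + 1) * (Real.pi * x)) =
      Real.cos (2 * Real.pi * (n + 1 / 2) * y) := by
    rw [show 2 * Real.pi * (n + 1 / 2) * y =
      ((2 * n + 1) * (Real.pi * x) - Real.pi / 2) - n * Real.pi by rw [hy]; ring,
      Real.cos_sub_nat_mul_pi, Real.cos_sub_pi_div_two]
  have hneg : F (-((n : ℤ) + 1)) = Real.exp (-(2 * Real.pi ^ 2 / t) * ((n : ℝ) + 1 / 2) ^ 2) *
      Complex.exp (-(2 * Real.pi * (n + 1 / 2) * y) * Complex.I) := by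
    rw [hF]
    push_cast
    congr 2 <;> ring
  have hFn : F (n : ℤ) = Real.exp (-(2 * Real.pi ^ 2 / t) * ((n : ℝ) + 1 / 2) ^ 2) *
      Complex.exp ((2 * Real.pi * (n + 1 / 2) * y) * Complex.I) := by
    rw [hF]
    push_cast
    rfl
  rw [hneg, hFn, ← mul_add, ← Complex.two_cos, mul_right_comm, hsin, hexp]
  push_cast
  ring

/-! ### The sine series divided by the sine -/

/-- The Dirichlet kernel `sin ((2n+1)θ) / sin θ`, written as a cosine sum so that it is defined at
the zeros of the sine as well. -/
noncomputable def dirichletKer (n : ℕ) (θ : ℝ) : ℝ :=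
  1 + 2 * ∑ j ∈ Finset.range n, Real.cos (2 * (j + 1) * θ)

theorem sin_mul_dirichletKer (n : ℕ) (θ : ℝ) :
    Real.sin θ * dirichletKer n θ = Real.sin ((2 * n + 1) * θ) := by
  induction n with
  | zero => simp [dirichletKer]
  | succ n ih =>
    have e : dirichletKer (n + 1) θ = dirichletKer n θ + 2 * Real.cos (2 * (n + 1) * θ) := by
      rw [dirichletKer, dirichletKer, Finset.sum_range_succ]; ring
    have h1 : (2 * ((n + 1 : ℕ) : ℝ) + 1) * θ = 2 * (n + 1) * θ + θ := by push_cast; ring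
    have h2 : (2 * (n : ℝ) + 1) * θ = 2 * (n + 1) * θ - θ := by ring
    rw [e, mul_add, ih, h1, h2, Real.sin_add, Real.sin_sub]
    ring

theorem abs_dirichletKer_le (n : ℕ) (θ : ℝ) : |dirichletKer n θ| ≤ 2 * n + 1 := by
  have h : |∑ j ∈ Finset.range n, Real.cos (2 * (j + 1) * θ)| ≤ n := by
    refine (Finset.abs_sum_le_sum_abs _ _).trans ?_
    refine (Finset.sum_le_sum fun j _ => Real.abs_cos_le_one _).trans ?_
    simp
  have := abs_le.mp h
  rw [dirichletKer, abs_le]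
  constructor <;> linarith

theorem continuous_dirichletKer (n : ℕ) : Continuous (dirichletKer n) := by
  unfold dirichletKer
  fun_prop

theorem dirichletKer_pi_mul_intCast (n : ℕ) (m : ℤ) :
    dirichletKer n (Real.pi * m) = dirichletKer n (Real.pi * 0) := by
  unfold dirichletKer
  congr 2
  refine Finset.sum_congr rfl fun j _ => ?_
  rw [mul_zero, mul_zero, Real.cos_zero, show 2 * ((j : ℝ) + 1) * (Real.pi * m) =
    (((j + 1) * m : ℤ) : ℝ) * (2 * Real.pi) by push_cast; ring, Real.cos_int_mul_two_pi]

/-- The quotient of the sine series of a theta function by `sin (π x)`: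
`∑ (-1)^n e^{-c n (n+1)} sin ((2n+1) π x) / sin (π x)`. -/
noncomputable def thetaSinQuot (c x : ℝ) : ℝ :=
  ∑' n : ℕ, (-1) ^ n * Real.exp (-c * (n * (n + 1))) * dirichletKer n (Real.pi * x)

/-- The numerical threshold `0.26` makes the ratio of consecutive terms at most
`5 / 3 * 0.26 ^ 2 < 1 / 8`. -/
theorem thetaSinQuot_term_le {c : ℝ} (hc : Real.exp (-2 * c) ≤ 26 / 100) (m : ℕ) :
    (2 * (m + 1 : ℕ) + 1) * Real.exp (-c * ((m + 1 : ℕ) * ((m + 1 : ℕ) + 1))) ≤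
      3 * Real.exp (-2 * c) * (1 / 8) ^ m := by
  induction m with
  | zero => norm_num [mul_comm]
  | succ m ih =>
    have e : Real.exp (-c * ((m + 1 + 1 : ℕ) * ((m + 1 + 1 : ℕ) + 1))) =
        Real.exp (-c * ((m + 1 : ℕ) * ((m + 1 : ℕ) + 1))) * Real.exp (-2 * c) ^ (m + 2) := by
      rw [← Real.exp_nat_mul, ← Real.exp_add]
      congr 1
      push_cast
      ring
    have hρ := Real.exp_pos (-2 * c)
    have h2 : Real.exp (-2 * c) ^ (m + 2) ≤ (26 / 100) ^ 2 := by
      refine (pow_le_pow_of_le_one hρ.le (by linarith) (by omega : 2 ≤ m + 2)).trans ?_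
      gcongr
    set A := Real.exp (-c * ((m + 1 : ℕ) * ((m + 1 : ℕ) + 1)))
    have hA : 0 < A := Real.exp_pos _
    have h3 : (2 * ((m + 1 + 1 : ℕ) : ℝ) + 1) * (26 / 100) ^ 2 ≤
        (2 * ((m + 1 : ℕ) : ℝ) + 1) * (1 / 8) := by
      have : (0 : ℝ) ≤ m := m.cast_nonneg
      push_cast
      linarith
    calc (2 * ((m + 1 + 1 : ℕ) : ℝ) + 1) * Real.exp (-c * ((m + 1 + 1 : ℕ) * ((m + 1 + 1 : ℕ) + 1)))
        = (2 * ((m + 1 + 1 : ℕ) : ℝ) + 1) * (A * Real.exp (-2 * c) ^ (m + 2)) := by rw [e]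
      _ ≤ (2 * ((m + 1 + 1 : ℕ) : ℝ) + 1) * (A * (26 / 100) ^ 2) := by gcongr
      _ = A * ((2 * ((m + 1 + 1 : ℕ) : ℝ) + 1) * (26 / 100) ^ 2) := by ring
      _ ≤ A * ((2 * ((m + 1 : ℕ) : ℝ) + 1) * (1 / 8)) := by gcongr
      _ = ((2 * ((m + 1 : ℕ) : ℝ) + 1) * A) * (1 / 8) := by ring
      _ ≤ (3 * Real.exp (-2 * c) * (1 / 8) ^ m) * (1 / 8) := by gcongr
      _ = 3 * Real.exp (-2 * c) * (1 / 8) ^ (m + 1) := by ring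

theorem summable_thetaSinQuot_majorant {c : ℝ} (hc : Real.exp (-2 * c) ≤ 26 / 100) :
    Summable fun n : ℕ => (2 * (n : ℝ) + 1) * Real.exp (-c * (n * (n + 1))) := by
  refine (summable_nat_add_iff 1).mp (Summable.of_nonneg_of_le (fun n => by positivity)
    (thetaSinQuot_term_le hc) ((summable_geometric_of_lt_one ?_ ?_).mul_left _)) <;> norm_num

theorem norm_thetaSinQuot_term_le (c x : ℝ) (n : ℕ) :
    ‖(-1) ^ n * Real.exp (-c * (n * (n + 1))) * dirichletKer n (Real.pi * x)‖ ≤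
      (2 * (n : ℝ) + 1) * Real.exp (-c * (n * (n + 1))) := by
  rw [norm_mul, norm_mul, norm_pow, norm_neg, norm_one, one_pow, one_mul, mul_comm,
    Real.norm_of_nonneg (Real.exp_pos _).le]
  exact mul_le_mul_of_nonneg_right (abs_dirichletKer_le _ _) (Real.exp_pos _).le

theorem summable_thetaSinQuot {c : ℝ} (hc : Real.exp (-2 * c) ≤ 26 / 100) (x : ℝ) :
    Summable fun n : ℕ =>
      (-1) ^ n * Real.exp (-c * (n * (n + 1))) * dirichletKer n (Real.pi * x) :=
  (summable_thetaSinQuot_majorant hc).of_norm_bounded (norm_thetaSinQuot_term_le c x)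

theorem continuous_thetaSinQuot {c : ℝ} (hc : Real.exp (-2 * c) ≤ 26 / 100) :
    Continuous (thetaSinQuot c) :=
  continuous_tsum
    (fun n => continuous_const.mul ((continuous_dirichletKer n).comp (continuous_const_mul _)))
    (summable_thetaSinQuot_majorant hc) fun n x => norm_thetaSinQuot_term_le c x n

theorem thetaSinQuot_intCast (c : ℝ) (m : ℤ) : thetaSinQuot c m = thetaSinQuot c 0 := by
  simp_rw [thetaSinQuot, dirichletKer_pi_mul_intCast]

theorem abs_thetaSinQuot_sub_one_le {c : ℝ} (hc : Real.exp (-2 * c) ≤ 26 / 100) (x : ℝ) :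
    |thetaSinQuot c x - 1| ≤ 24 / 7 * Real.exp (-2 * c) := by
  have hg : HasSum (fun m : ℕ => 3 * Real.exp (-2 * c) * (1 / 8) ^ m)
      (3 * Real.exp (-2 * c) * (1 - 1 / 8)⁻¹) :=
    (hasSum_geometric_of_lt_one (by norm_num) (by norm_num)).mul_left _
  have h := (summable_thetaSinQuot hc x).tsum_eq_zero_add
  have e : thetaSinQuot c x - 1 = ∑' n : ℕ, (-1) ^ (n + 1) *
      Real.exp (-c * ((n + 1 : ℕ) * ((n + 1 : ℕ) + 1))) * dirichletKer (n + 1) (Real.pi * x) := by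
    rw [thetaSinQuot, h]
    simp [dirichletKer]
  rw [e, ← Real.norm_eq_abs]
  refine (tsum_of_norm_bounded hg fun m => ?_).trans (by norm_num; linarith [Real.exp_pos (-2 * c)])
  exact (norm_thetaSinQuot_term_le c x (m + 1)).trans (thetaSinQuot_term_le hc m)

theorem thetaSinQuot_pos {c : ℝ} (hc : Real.exp (-2 * c) ≤ 26 / 100) (x : ℝ) :
    1 / 10 < thetaSinQuot c x := by
  have := (abs_le.mp (abs_thetaSinQuot_sub_one_le hc x)).1
  linarith

/-- This estimate yields all the error terms: each approximation equals the exact value times a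
quotient of two values of `thetaSinQuot c`. -/
theorem abs_one_sub_thetaSinQuot_div_le {c : ℝ} (hc : Real.exp (-2 * c) ≤ 26 / 100) (x y : ℝ) :
    |1 - thetaSinQuot c x / thetaSinQuot c y| ≤ 70 * Real.exp (-2 * c) := by
  have hy := thetaSinQuot_pos hc y
  have hy0 : 0 < thetaSinQuot c y := by linarith
  have h1 := abs_le.mp (abs_thetaSinQuot_sub_one_le hc x)
  have h2 := abs_le.mp (abs_thetaSinQuot_sub_one_le hc y)
  have hρ := Real.exp_pos (-2 * c)
  rw [one_sub_div hy0.ne', abs_div, abs_of_pos hy0, div_le_iff₀ hy0]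
  refine (abs_le.mpr ⟨?_, ?_⟩ : _ ≤ 7 * Real.exp (-2 * c)).trans ?_
  · linarith
  · linarith
  · nlinarith

/-! ### The theta function as a sine series -/

/-- `q^((x-1/2)^2/2) (q^x;q)_∞ (q^(1-x);q)_∞`, which is up to a factor independent of `x` the theta
function `∑ (-1)^n q^((n+x-1/2)^2/2)`. -/
noncomputable def qTheta (q x : ℝ) : ℝ :=
  q ^ ((x - 1 / 2) ^ 2 / 2) * (qShiftedInf (q ^ x) q * qShiftedInf (q ^ (1 - x)) q)

/-- The triple product followed by Poisson summation, for `q = e^{-t}`. -/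
theorem exists_pos_mul_qTheta_eq {t : ℝ} (ht : 0 < t)
    (hc : Real.exp (-2 * (2 * Real.pi ^ 2 / t)) ≤ 26 / 100) :
    ∃ K : ℝ, 0 < K ∧ ∀ x, K * qTheta (Real.exp (-t)) x =
      Real.sin (Real.pi * x) * thetaSinQuot (2 * Real.pi ^ 2 / t) x := by
  have hpi := Real.pi_pos
  have h0 := Real.exp_pos (-t)
  have h1 : Real.exp (-t) < 1 := Real.exp_lt_one_iff.mpr (by linarith)
  have hP := qShiftedInf_self_pos h0 h1
  refine ⟨(t / (2 * Real.pi)) ^ (1 / 2 : ℝ) * Real.exp (Real.pi ^ 2 / (2 * t)) / 2 *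
    qShiftedInf (Real.exp (-t)) (Real.exp (-t)), by positivity, fun x => ?_⟩
  have hs : Summable fun j : ℤ => (-1) ^ j * Real.exp (-(t / 2) * (j + (x - 1 / 2)) ^ 2) :=
    (summable_exp_neg_mul_int_add_sq (half_pos ht) (x - 1 / 2)).of_norm_bounded fun j => by
      rw [norm_mul, norm_zpow, norm_neg, norm_one, one_zpow, one_mul,
        Real.norm_of_nonneg (Real.exp_pos _).le]
  -- with `z = q^x` `(-1)^j q^((j+x-1/2)^2/2)` satisfies the recurrence of the triple product
  have htriple := tsum_eq_mul_qShiftedInf (z := Real.exp (-t) ^ x) h0 h1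
    (Real.rpow_pos_of_pos h0 x).ne' (fun j => ?_) hs
  · have hsin : HasSum _ (Real.sin (Real.pi * x) * thetaSinQuot (2 * Real.pi ^ 2 / t) x) :=
      (summable_thetaSinQuot hc x).hasSum.mul_left (Real.sin (Real.pi * x))
    have hq : Real.exp (-t) / Real.exp (-t) ^ x = Real.exp (-t) ^ (1 - x) := by
      rw [Real.rpow_sub h0, Real.rpow_one]
    have hT : (-1) ^ (0 : ℤ) * Real.exp (-(t / 2) * ((0 : ℤ) + (x - 1 / 2)) ^ 2) =
        Real.exp (-t) ^ ((x - 1 / 2) ^ 2 / 2) := by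
      rw [← Real.exp_mul, zpow_zero, one_mul]
      congr 1
      push_cast
      ring
    rw [hT, hq] at htriple
    rw [qTheta, mul_assoc, ← htriple]
    refine (hasSum_neg_one_pow_mul_exp_mul_sin ht x).unique (hsin.congr_fun fun n => ?_)
    rw [← sin_mul_dirichletKer]
    ring
  · rw [zpow_add₀ (by norm_num), zpow_one, ← Real.exp_mul,
      ← Real.rpow_intCast (Real.exp (-t)), ← Real.exp_mul, ← Real.exp_add]
    have e : Real.exp (-(t / 2) * (((j + 1 : ℤ) : ℝ) + (x - 1 / 2)) ^ 2) =
        Real.exp (-t * j + -t * x) * Real.exp (-(t / 2) * (j + (x - 1 / 2)) ^ 2) := by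
      rw [← Real.exp_add]
      congr 1
      push_cast
      ring
    rw [e]
    ring

theorem qShiftedInf_eq_one_sub_mul {q : ℝ} (hq : |q| < 1) (a : ℝ) :
    qShiftedInf a q = (1 - a) * qShiftedInf (a * q) q := by
  refine tendsto_nhds_unique ((tendsto_add_atTop_iff_nat 1).mpr (tendsto_qShifted a hq))
    (((tendsto_qShifted (a * q) hq).const_mul (1 - a)).congr fun n => ?_)
  simp only [qShifted]
  rw [Finset.prod_range_succ', mul_comm]
  simp only [pow_succ', pow_zero, mul_one, mul_assoc]

theorem continuous_qShiftedInf {q : ℝ} (hq : |q| < 1) : Continuous fun a => qShiftedInf a q := by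
  refine continuous_iff_continuousAt.mpr fun a => ?_
  have hu : Summable fun k : ℕ => (|a| + 1) * |q| ^ k :=
    (summable_geometric_of_lt_one (abs_nonneg q) hq).mul_left _
  have h := (Summable.hasProdLocallyUniformlyOn_nat_one_add (K := Metric.ball a 1)
    (f := fun (k : ℕ) (b : ℝ) => -(b * q ^ k)) Metric.isOpen_ball hu
    (Eventually.of_forall fun k b hb => ?_) fun k => by fun_prop)
  · have hc : ContinuousOn (fun b => ∏' k : ℕ, (1 + -(b * q ^ k))) (Metric.ball a 1) := by
      refine h.tendstoLocallyUniformlyOn_finsetRange.continuousOn (Frequently.of_forall fun n => ?_)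
      fun_prop
    simpa [qShiftedInf, sub_eq_add_neg] using
      hc.continuousAt (Metric.isOpen_ball.mem_nhds (Metric.mem_ball_self one_pos))
  · rw [norm_neg, norm_mul, norm_pow, Real.norm_eq_abs, Real.norm_eq_abs]
    refine mul_le_mul_of_nonneg_right ?_ (by positivity)
    have h1 : |b - a| < 1 := by simpa [Real.dist_eq] using hb
    have h2 := abs_add_le a (b - a)
    rw [add_sub_cancel] at h2
    linarith

/-- Comparison of derivatives at the zero `x = 0` of the theta function: if `K * qTheta q x` equals
`sin (π x) * V x`, then `π * V 0` is determined by `(q;q)_∞`. -/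
theorem pi_mul_eq_of_mul_qTheta_eq {t K : ℝ} (ht : 0 < t) {V : ℝ → ℝ} (hV : Continuous V)
    (h : ∀ x, K * qTheta (Real.exp (-t)) x = Real.sin (Real.pi * x) * V x) :
    Real.pi * V 0 = K * (Real.exp (-t) ^ (1 / 8 : ℝ) * t *
      qShiftedInf (Real.exp (-t)) (Real.exp (-t)) ^ 2) := by
  set q := Real.exp (-t) with hq
  have h0 : 0 < q := Real.exp_pos (-t)
  have h1 : |q| < 1 := by rw [abs_of_pos h0]; exact Real.exp_lt_one_iff.mpr (by linarith)
  have hl : HasDerivAt (fun x => Real.sin (Real.pi * x)) Real.pi 0 := by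
    simpa using ((hasDerivAt_id (0 : ℝ)).const_mul Real.pi).sin
  have hr : HasDerivAt (fun x => 1 - Real.exp (-t * x)) t 0 := by
    simpa using (((hasDerivAt_id (0 : ℝ)).const_mul (-t)).exp).const_sub 1
  have hV0 : Tendsto V (𝓝[≠] 0) (𝓝 (V 0)) := hV.continuousAt.mono_left nhdsWithin_le_nhds
  set W : ℝ → ℝ := fun x =>
    q ^ ((x - 1 / 2) ^ 2 / 2) * (qShiftedInf (q ^ x * q) q * qShiftedInf (q ^ (1 - x)) q) with hW
  have hWc : Continuous W := by
    have hc := continuous_qShiftedInf h1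
    have hp : ∀ f : ℝ → ℝ, Continuous f → Continuous fun x => q ^ f x := fun f hf =>
      continuous_const.rpow hf fun x => Or.inl h0.ne'
    exact (hp _ (by fun_prop)).mul ((hc.comp ((hp _ continuous_id).mul continuous_const)).mul
      (hc.comp (hp _ (by fun_prop))))
  have hW0 : Tendsto W (𝓝[≠] 0) (𝓝 (W 0)) := hWc.continuousAt.mono_left nhdsWithin_le_nhds
  have hl' := (hasDerivAt_iff_tendsto_slope.mp hl).mul hV0
  have hr' := ((hasDerivAt_iff_tendsto_slope.mp hr).mul hW0).const_mul K
  have hW0' : W 0 = q ^ (1 / 8 : ℝ) * qShiftedInf q q ^ 2 := by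
    simp only [hW, Real.rpow_zero, one_mul, sub_zero, Real.rpow_one, sq]
    norm_num
  rw [show K * (q ^ (1 / 8 : ℝ) * t * qShiftedInf q q ^ 2) = K * (t * W 0) by rw [hW0']; ring]
  refine tendsto_nhds_unique (hl'.congr fun x => ?_) hr'
  have hx := h x
  rw [qTheta, qShiftedInf_eq_one_sub_mul h1 (q ^ x)] at hx
  have e : q ^ x = Real.exp (-t * x) := by rw [hq, ← Real.exp_mul]
  simp only [slope_def_field, mul_zero, Real.sin_zero, Real.exp_zero, sub_self, sub_zero, hW]
  rw [div_mul_eq_mul_div, ← hx, ← e]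
  ring

/-! ### Infinite products and the `q`-gamma function -/

theorem hasProd_one_sub_rpow_add {q : ℝ} (h0 : 0 < q) (h1 : q < 1) (x : ℝ) :
    HasProd (fun k : ℕ => 1 - q ^ ((k : ℝ) + x)) (qShiftedInf (q ^ x) q) := by
  refine (multipliable_qShifted (q ^ x) (by rwa [abs_of_pos h0])).hasProd.congr_fun fun k => ?_
  rw [Real.rpow_add h0, Real.rpow_natCast, mul_comm]

/-- The numerator common to all the infinite products of the statement. -/
theorem hasProd_one_sub_rpow_mul {q : ℝ} (h0 : 0 < q) (h1 : q < 1) (x : ℝ) :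
    HasProd (fun k : ℕ => (1 - q ^ ((k : ℝ) + x)) * (1 - q ^ ((k : ℝ) + 1 - x)))
      (qShiftedInf (q ^ x) q * qShiftedInf (q ^ (1 - x)) q) := by
  refine ((hasProd_one_sub_rpow_add h0 h1 x).mul
    (hasProd_one_sub_rpow_add h0 h1 (1 - x))).congr_fun fun k => ?_
  rw [add_sub_assoc]

theorem hasProd_one_sub_rpow_add_sq {q : ℝ} (h0 : 0 < q) (h1 : q < 1) (x : ℝ) :
    HasProd (fun k : ℕ => (1 - q ^ ((k : ℝ) + x)) ^ 2) (qShiftedInf (q ^ x) q ^ 2) := by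
  simp_rw [sq]
  exact (hasProd_one_sub_rpow_add h0 h1 x).mul (hasProd_one_sub_rpow_add h0 h1 x)

theorem hasProd_sinFactorOne {q : ℝ} (h0 : 0 < q) (h1 : q < 1)
    (hne : qShiftedInf (q ^ (1 / 2 : ℝ)) q ≠ 0) (x : ℝ) :
    HasProd (sinFactorOne q x) (qShiftedInf (q ^ x) q * qShiftedInf (q ^ (1 - x)) q /
      qShiftedInf (q ^ (1 / 2 : ℝ)) q ^ 2) :=
  (hasProd_one_sub_rpow_mul h0 h1 x).div₀ (hasProd_one_sub_rpow_add_sq h0 h1 (1 / 2))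
    (pow_ne_zero 2 hne)

theorem hasProd_sinFactorTwo {q : ℝ} (h0 : 0 < q) (h1 : q < 1) (x : ℝ) :
    HasProd (sinFactorTwo q x) (qShiftedInf (q ^ x) q * qShiftedInf (q ^ (1 - x)) q /
      qShiftedInf q q ^ 2) := by
  have h := hasProd_one_sub_rpow_add_sq h0 h1 1
  rw [Real.rpow_one] at h
  exact (hasProd_one_sub_rpow_mul h0 h1 x).div₀ h
    (pow_ne_zero 2 (qShiftedInf_self_pos h0 h1).ne')

theorem hasProd_piFactor {q : ℝ} (h0 : 0 < q) (h1 : q < 1) {x : ℝ}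
    (hne : qShiftedInf (q ^ x) q * qShiftedInf (q ^ (1 - x)) q ≠ 0) :
    HasProd (piFactor q x) (qShiftedInf q q ^ 2 /
      (qShiftedInf (q ^ x) q * qShiftedInf (q ^ (1 - x)) q)) := by
  have h := hasProd_one_sub_rpow_add_sq h0 h1 1
  rw [Real.rpow_one] at h
  exact h.div₀ (hasProd_one_sub_rpow_mul h0 h1 x) hne

/-- This holds at the poles as well, where both sides are `0` by the convention for division. -/
theorem qGamma_mul_qGamma_one_sub {q : ℝ} (h1 : q < 1) (x : ℝ) :
    qGamma q x * qGamma q (1 - x) =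
      qShiftedInf q q ^ 2 / (qShiftedInf (q ^ x) q * qShiftedInf (q ^ (1 - x)) q) * (1 - q) := by
  have h : (1 - q) ^ (1 - x) * (1 - q) ^ (1 - (1 - x)) = 1 - q := by
    rw [← Real.rpow_add (by linarith), show 1 - x + (1 - (1 - x)) = 1 by ring, Real.rpow_one]
  calc qGamma q x * qGamma q (1 - x)
      = qShiftedInf q q / qShiftedInf (q ^ x) q * (qShiftedInf q q / qShiftedInf (q ^ (1 - x)) q) *
          ((1 - q) ^ (1 - x) * (1 - q) ^ (1 - (1 - x))) := by unfold qGamma; ring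
    _ = _ := by rw [h, div_mul_div_comm, sq]

theorem sinApproxOne_eq_mul_tprod {q : ℝ} (h0 : 0 < q) (h1 : q < 1)
    (hne : qShiftedInf (q ^ (1 / 2 : ℝ)) q ≠ 0) (x : ℝ) :
    sinApproxOne q x = q ^ ((x - 1 / 2) ^ 2 / 2) * ∏' k : ℕ, sinFactorOne q x k := by
  have hg : qGamma q (1 / 2) ^ 2 =
      qShiftedInf q q ^ 2 / qShiftedInf (q ^ (1 / 2 : ℝ)) q ^ 2 * (1 - q) := by
    have := qGamma_mul_qGamma_one_sub h1 (1 / 2)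
    rwa [show (1 : ℝ) - 1 / 2 = 1 / 2 by norm_num, ← sq, ← sq] at this
  have hP := (qShiftedInf_self_pos h0 h1).ne'
  have hq : 1 - q ≠ 0 := by linarith
  rw [sinApproxOne, (hasProd_sinFactorOne h0 h1 hne x).tprod_eq, hg, qGamma_mul_qGamma_one_sub h1,
    mul_div_mul_right _ _ hq, div_div_div_eq, mul_comm (qShiftedInf q q ^ 2),
    mul_div_mul_right _ _ (pow_ne_zero 2 hP)]

theorem sinApproxTwo_eq_mul_tprod {q : ℝ} (h0 : 0 < q) (h1 : q < 1) (x : ℝ) :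
    sinApproxTwo q x = Real.pi * q ^ (x * (x - 1) / 2) * (1 / Real.log q⁻¹) *
      ∏' k : ℕ, sinFactorTwo q x k := by
  have hq : 1 - q ≠ 0 := by linarith
  rw [sinApproxTwo, (hasProd_sinFactorTwo h0 h1 x).tprod_eq, mul_assoc (Real.log q⁻¹),
    qGamma_mul_qGamma_one_sub h1, ← mul_assoc (Real.log q⁻¹), div_mul_cancel_right₀ hq]
  simp only [one_div, mul_inv, inv_div, mul_assoc]

theorem piApprox_eq_piApproxProd {q : ℝ} (h0 : 0 < q) (h1 : q < 1) {x : ℝ}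
    (hne : qShiftedInf (q ^ x) q * qShiftedInf (q ^ (1 - x)) q ≠ 0) :
    piApprox q x = piApproxProd q x := by
  have hq : 1 - q ≠ 0 := by linarith
  rw [piApprox, piApproxProd, (hasProd_piFactor h0 h1 hne).tprod_eq, mul_assoc (Real.log q⁻¹),
    qGamma_mul_qGamma_one_sub h1, ← mul_assoc (Real.log q⁻¹), mul_div_cancel_right₀ _ hq]
  ring

/-- The lower bound `4 * 10^(-13)` for `q = e^{-t}` is what keeps the series `thetaSinQuot` away
from `0`. -/
theorem exp_neg_two_mul_le {t : ℝ} (ht : 0 < t) (hq : 4 / 10 ^ 13 < Real.exp (-t)) :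
    Real.exp (-2 * (2 * Real.pi ^ 2 / t)) ≤ 26 / 100 := by
  have he := Real.exp_one_gt_d9
  -- `4 * 10^(-13) > e^{-29}`
  have ht29 : t < 29 := by
    by_contra! h
    have h2 : (2.7182818283 : ℝ) ^ 29 ≤ Real.exp t := by
      refine (pow_le_pow_left₀ (by norm_num) he.le 29).trans ?_
      rw [← Real.exp_nat_mul]
      exact Real.exp_le_exp.mpr (by push_cast; linarith)
    have h3 : Real.exp t * Real.exp (-t) = 1 := by rw [← Real.exp_add]; simp
    have h4 : (2.7182818283 : ℝ) ^ 29 * (4 / 10 ^ 13) < 1 := by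
      rw [← h3]
      exact (mul_le_mul_of_nonneg_right h2 (by norm_num)).trans_lt
        (mul_lt_mul_of_pos_left hq (Real.exp_pos t))
    norm_num at h4
  -- `t < 29` gives `4π²/t ≥ 27/20`, and `e^{-27/20}` is just below `0.26`
  have hexp : Real.exp (-(27 / 20)) ≤ 26 / 100 := by
    refine le_of_pow_le_pow_left₀ (n := 20) (by norm_num) (by norm_num) ?_
    rw [← Real.exp_nat_mul, show ((20 : ℕ) : ℝ) * -(27 / 20) = -((27 : ℕ) * 1) by norm_num,
      Real.exp_neg, Real.exp_nat_mul]
    calc (Real.exp 1 ^ 27)⁻¹ ≤ ((2.7182818283 : ℝ) ^ 27)⁻¹ := by gcongr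
      _ ≤ (26 / 100) ^ 20 := by norm_num
  refine (Real.exp_le_exp.mpr ?_).trans hexp
  have hpi := Real.pi_gt_d2
  have : 27 / 40 ≤ 2 * Real.pi ^ 2 / t := by
    rw [le_div_iff₀ ht]
    nlinarith
  linarith

/-! ### The approximations -/

theorem mainTheorem9 :
    ∃ C : ℝ, ∀ q : ℝ, 4 / 10 ^ 13 < q → q < 1 →
      -- first approximation of the sine, with `q`-gamma functions and as an infinite product
      (∀ x : ℝ,
        |Real.sin (Real.pi * x) - sinApproxOne q x| ≤ C * Real.exp (Real.pi ^ 2 / Real.log q) ∧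
        Multipliable (sinFactorOne q x) ∧
        |Real.sin (Real.pi * x) - q ^ ((x - 1 / 2) ^ 2 / 2) * ∏' k : ℕ, sinFactorOne q x k|
          ≤ C * Real.exp (Real.pi ^ 2 / Real.log q)) ∧
      -- second approximation of the sine, with `q`-gamma functions and as an infinite product
      (∀ x : ℝ,
        |Real.sin (Real.pi * x) - sinApproxTwo q x| ≤ C * Real.exp (Real.pi ^ 2 / Real.log q) ∧
        Multipliable (sinFactorTwo q x) ∧
        |Real.sin (Real.pi * x)
            - Real.pi * q ^ (x * (x - 1) / 2) * (1 / Real.log q⁻¹) * ∏' k : ℕ, sinFactorTwo q x k|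
          ≤ C * Real.exp (Real.pi ^ 2 / Real.log q)) ∧
      -- two-parameter approximation of `π`, away from the removable singularities
      (∀ x : ℝ, (∀ n : ℤ, x ≠ n) →
        |Real.pi - piApprox q x| ≤ C * Real.exp (Real.pi ^ 2 / Real.log q) ∧
        Multipliable (piFactor q x) ∧
        |Real.pi - piApproxProd q x| ≤ C * Real.exp (Real.pi ^ 2 / Real.log q)) ∧
      -- at an integer both expressions are read as limits, and these are equal to `π`
      (∀ n : ℤ,
        Tendsto (piApprox q) (𝓝[≠] (n : ℝ)) (𝓝 Real.pi) ∧
        Tendsto (piApproxProd q) (𝓝[≠] (n : ℝ)) (𝓝 Real.pi)) := by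
  refine ⟨Real.pi * 70, fun q hq4 h1 => ?_⟩
  have h0 : 0 < q := lt_trans (by norm_num) hq4
  obtain ⟨t, ht, rfl⟩ : ∃ t : ℝ, 0 < t ∧ q = Real.exp (-t) :=
    ⟨-Real.log q, neg_pos.mpr (Real.log_neg h0 h1), by rw [neg_neg, Real.exp_log h0]⟩
  have hc := exp_neg_two_mul_le ht hq4
  obtain ⟨K, hK, hTheta⟩ := exists_pos_mul_qTheta_eq ht hc
  have hpiV := pi_mul_eq_of_mul_qTheta_eq ht (continuous_thetaSinQuot hc) hTheta
  set q := Real.exp (-t) with hqt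
  set V := thetaSinQuot (2 * Real.pi ^ 2 / t) with hVdef
  have hVpos : ∀ x, 0 < V x := fun x => lt_trans (by norm_num) (thetaSinQuot_pos hc x)
  have hP := qShiftedInf_self_pos h0 h1
  have hlog : Real.log q⁻¹ = t := by rw [Real.log_inv, hqt, Real.log_exp, neg_neg]
  have herr : Real.exp (-2 * (2 * Real.pi ^ 2 / t)) ≤ Real.exp (Real.pi ^ 2 / Real.log q) := by
    rw [Real.exp_le_exp, hqt, Real.log_exp, div_neg]
    have : 0 ≤ Real.pi ^ 2 / t := by positivity
    rw [mul_div_assoc]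
    linarith
  have hpi1 : 1 ≤ Real.pi := by linarith [Real.pi_gt_three]
  -- the factor `π` in the constant is needed for the third approximation only
  have hbound : ∀ x y, Real.pi * |1 - V x / V y| ≤
      Real.pi * 70 * Real.exp (Real.pi ^ 2 / Real.log q) := fun x y => by
    have := (abs_one_sub_thetaSinQuot_div_le hc x y).trans
      (mul_le_mul_of_nonneg_left herr (by norm_num))
    rw [mul_assoc]
    gcongr
  have hsinbound : ∀ x y, |Real.sin (Real.pi * x) - Real.sin (Real.pi * x) * (V x / V y)| ≤
      Real.pi * 70 * Real.exp (Real.pi ^ 2 / Real.log q) := fun x y => by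
    rw [← mul_one_sub, abs_mul]
    exact (mul_le_mul_of_nonneg_right ((Real.abs_sin_le_one _).trans hpi1)
      (abs_nonneg _)).trans (hbound x y)
  have hhalf : qShiftedInf (q ^ (1 / 2 : ℝ)) q ≠ 0 := fun h => by
    have := hTheta (1 / 2)
    rw [qTheta, h, zero_mul, mul_zero, mul_zero, mul_one_div, Real.sin_pi_div_two, one_mul] at this
    exact (hVpos _).ne this
  have hone : ∀ x, sinApproxOne q x = Real.sin (Real.pi * x) * (V x / V (1 / 2)) := fun x => by
    have e : V (1 / 2) = K * qShiftedInf (q ^ (1 / 2 : ℝ)) q ^ 2 := by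
      have := hTheta (1 / 2)
      rw [qTheta, mul_one_div, Real.sin_pi_div_two, one_mul] at this
      rw [← this, show (1 : ℝ) - 1 / 2 = 1 / 2 by norm_num, sub_self]
      norm_num [sq]
    rw [sinApproxOne_eq_mul_tprod h0 h1 hhalf, (hasProd_sinFactorOne h0 h1 hhalf x).tprod_eq,
      ← mul_div_assoc (Real.sin _), ← hTheta, e, mul_div_mul_left _ _ hK.ne', qTheta]
    ring
  have hsplit : ∀ x : ℝ, q ^ ((x - 1 / 2) ^ 2 / 2) = q ^ (1 / 8 : ℝ) * q ^ (x * (x - 1) / 2) :=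
    fun x => by rw [← Real.rpow_add h0]; congr 1; ring
  have htwo : ∀ x, sinApproxTwo q x = Real.sin (Real.pi * x) * (V x / V 0) := fun x => by
    have hq8 := Real.rpow_pos_of_pos h0 (1 / 8)
    rw [sinApproxTwo_eq_mul_tprod h0 h1, (hasProd_sinFactorTwo h0 h1 x).tprod_eq, hlog,
      ← mul_div_assoc (Real.sin _), ← hTheta, eq_div_iff (hVpos 0).ne', qTheta, hsplit]
    refine mul_left_cancel₀ Real.pi_pos.ne' ?_
    rw [mul_left_comm, hpiV]
    field_simp
  have hsin : ∀ x : ℝ, (∀ n : ℤ, x ≠ n) → Real.sin (Real.pi * x) ≠ 0 := fun x hx h => by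
    obtain ⟨n, hn⟩ := Real.sin_eq_zero_iff.mp h
    exact hx n (mul_left_cancel₀ Real.pi_pos.ne' (by rw [← hn, mul_comm]))
  have hne : ∀ x : ℝ, (∀ n : ℤ, x ≠ n) →
      qShiftedInf (q ^ x) q * qShiftedInf (q ^ (1 - x)) q ≠ 0 := fun x hx h => by
    have := hTheta x
    rw [qTheta, h, mul_zero, mul_zero] at this
    exact mul_ne_zero (hsin x hx) (hVpos x).ne' this.symm
  have hpi : ∀ x : ℝ, (∀ n : ℤ, x ≠ n) → piApproxProd q x = Real.pi * (V 0 / V x) := fun x hx => by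
    have hq8 := Real.rpow_pos_of_pos h0 (1 / 8)
    have hqx := Real.rpow_pos_of_pos h0 (x * (x - 1) / 2)
    have hx' := hne x hx
    have hT := hTheta x
    rw [qTheta, hsplit] at hT
    rw [piApproxProd, (hasProd_piFactor h0 h1 hx').tprod_eq, hlog, ← mul_div_assoc Real.pi, hpiV,
      neg_div, Real.rpow_neg h0.le, ← mul_div_assoc _ (_ ^ 2), div_eq_div_iff hx' (hVpos x).ne']
    calc _ = (Real.sin (Real.pi * x) * V x) * ((q ^ (x * (x - 1) / 2))⁻¹ * t *
          qShiftedInf q q ^ 2) := by ring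
      _ = _ := by rw [← hT]; field_simp
  have hpibound : ∀ x : ℝ, (∀ n : ℤ, x ≠ n) → |Real.pi - piApproxProd q x| ≤
      Real.pi * 70 * Real.exp (Real.pi ^ 2 / Real.log q) := fun x hx => by
    rw [hpi x hx, ← mul_one_sub, abs_mul, abs_of_pos Real.pi_pos]
    exact hbound 0 x
  have hlim : ∀ n : ℤ, Tendsto (piApproxProd q) (𝓝[≠] (n : ℝ)) (𝓝 Real.pi) ∧
      piApprox q =ᶠ[𝓝[≠] (n : ℝ)] piApproxProd q := fun n => by
    -- near `n` there are no other integers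
    have hev : ∀ᶠ x : ℝ in 𝓝[≠] (n : ℝ), ∀ m : ℤ, x ≠ m := by
      have hcl : IsClosed (((↑) : ℤ → ℝ) '' {n}ᶜ) :=
        Int.isClosedEmbedding_coe_real.isClosedMap _ (isClosed_discrete _)
      filter_upwards [mem_nhdsWithin_of_mem_nhds (hcl.compl_mem_nhds (x := (n : ℝ)) (by simp)),
        self_mem_nhdsWithin] with x hx hxn m hm
      refine hx ⟨m, fun hmn => hxn ?_, hm.symm⟩
      rw [Set.mem_singleton_iff] at hmn ⊢
      rw [hm, hmn]
    have hcont : Tendsto (fun x => Real.pi * (V 0 / V x)) (𝓝[≠] (n : ℝ)) (𝓝 Real.pi) := by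
      have h : ContinuousAt (fun x => Real.pi * (V 0 / V x)) n :=
        (continuous_const.mul (continuous_const.div (continuous_thetaSinQuot hc)
          fun x => (hVpos x).ne')).continuousAt
      have hn : Real.pi * (V 0 / V n) = Real.pi := by
        rw [hVdef, thetaSinQuot_intCast, div_self (hVpos 0).ne', mul_one]
      simpa only [ContinuousAt, hn] using h.mono_left nhdsWithin_le_nhds
    refine ⟨hcont.congr' ?_, ?_⟩
    · filter_upwards [hev] with x hx using (hpi x hx).symm
    · filter_upwards [hev] with x hx using piApprox_eq_piApproxProd h0 h1 (hne x hx)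
  refine ⟨fun x => ?_, fun x => ?_, fun x hx => ?_, fun n => ?_⟩
  · rw [← sinApproxOne_eq_mul_tprod h0 h1 hhalf, hone]
    exact ⟨hsinbound _ _, (hasProd_sinFactorOne h0 h1 hhalf x).multipliable, hsinbound _ _⟩
  · rw [← sinApproxTwo_eq_mul_tprod h0 h1, htwo]
    exact ⟨hsinbound _ _, (hasProd_sinFactorTwo h0 h1 x).multipliable, hsinbound _ _⟩
  · rw [piApprox_eq_piApproxProd h0 h1 (hne x hx)]
    exact ⟨hpibound x hx, (hasProd_piFactor h0 h1 (hne x hx)).multipliable, hpibound x hx⟩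
  · exact ⟨(hlim n).1.congr' (hlim n).2.symm, (hlim n).1⟩
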